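/- Let $m$ be an infinite cardinal and let $T$ be a one-ended tree, i.e. a tree that contains a ray (a one-sided infinite path) but no double ray (a two-sided infinite path). Suppose that the motion of $T$ is at least $m$, where the motion is the least number of vertices moved by a non-identity automorphism of $T$ and is regarded as larger than every cardinal if $T$ has no non-identity automorphism; this holds in particular if $T$ has motion exactly $m$. Suppose also that $\Delta(T)\le 2^m$, where $\Delta(T)$ is the least upper bound of the vertex degrees of $T$. Then $a(T)=2^{|T|}$, where $|T|$ is the number of vertices of $T$ and $a(T)$ is the number of asymmetrizing sets up to equivalence: a set $S\subseteq V(T)$ is asymmetrizing if the identity is the only automorphism $\varphi$ of $T$ with $\varphi(S)=S$, and asymmetrizing sets $S,S'$ are equivalent if $\varphi(S)=S'$ for some automorphism $\varphi$ of $T$. -/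

import Mathlib

open Cardinal

universe u

namespace TreeAsymmetrization

variable {V : Type u}

/-- The graph contains a ray, i.e. a one-sided infinite path. -/
def ContainsRay (G : SimpleGraph V) : Prop :=
  ∃ f : ℕ → V, Function.Injective f ∧ ∀ n : ℕ, G.Adj (f n) (f (n + 1))

/-- The graph contains a double ray, i.e. a two-sided infinite path. -/
def ContainsDoubleRay (G : SimpleGraph V) : Prop :=
  ∃ f : ℤ → V, Function.Injective f ∧ ∀ n : ℤ, G.Adj (f n) (f (n + 1))

/-- A one-ended tree: a tree that contains a ray but no double ray. -/
structure IsOneEndedTree (T : SimpleGraph V) : Prop where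
  isTree : T.IsTree
  containsRay : ContainsRay T
  not_containsDoubleRay : ¬ ContainsDoubleRay T

/-- `Δ(G)`: the least upper bound of the vertex degrees, as a cardinal. -/
noncomputable def maxDegree (G : SimpleGraph V) : Cardinal.{u} :=
  ⨆ v : V, #(G.neighborSet v)

/-- The motion of `G`: the least number of vertices moved by a non-identity automorphism. For an
asymmetric graph it is `⊤`, which is larger than every cardinal. -/
noncomputable def motion (G : SimpleGraph V) : WithTop Cardinal.{u} :=
  ⨅ φ : {φ : G ≃g G // φ ≠ RelIso.refl G.Adj},
    ((#{v : V // φ.1 v ≠ v} : Cardinal.{u}) : WithTop Cardinal.{u})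

/-- `S` is asymmetrizing for `G`: only the identity automorphism maps `S` onto itself. -/
def IsAsymmetrizing (G : SimpleGraph V) (S : Set V) : Prop :=
  ∀ φ : G ≃g G, φ '' S = S → φ = RelIso.refl G.Adj

/-- Equivalence of asymmetrizing sets: some automorphism of `G` maps one onto the other. -/
def asymmetrizingSetoid (G : SimpleGraph V) : Setoid {S : Set V // IsAsymmetrizing G S} where
  r S S' := ∃ φ : G ≃g G, φ '' S.1 = S'.1
  iseqv :=
    { refl := fun S => ⟨RelIso.refl G.Adj, by simp⟩
      symm := by
        rintro S S' ⟨φ, hφ⟩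
        refine ⟨φ.symm, ?_⟩
        rw [← hφ, ← Set.image_comp]
        simp
      trans := by
        rintro S S' S'' ⟨φ, hφ⟩ ⟨ψ, hψ⟩
        refine ⟨φ.trans ψ, ?_⟩
        rw [← hψ, ← hφ, ← Set.image_comp]
        rfl }

/-- The asymmetrizing number `a(G)`: the number of equivalence classes of asymmetrizing sets. -/
noncomputable def asymmetrizingNumber (G : SimpleGraph V) : Cardinal.{u} :=
  #(Quotient (asymmetrizingSetoid G))

end TreeAsymmetrization

namespace TreeAsymmetrization

variable {V : Type u}

/-! In a one-ended tree every vertex starts exactly one ray; let `p` send a vertex to the next one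
on it. As there is no double ray, no infinite chain of successive children exists, so descendant
trees allow induction, and every automorphism commutes with `p` and fixes some ancestor of each
vertex. Hence a set is asymmetrizing once no two siblings have isomorphic coloured descendant trees
(`IsParentMap.isAsymmetrizing`).

Swapping two isomorphic sibling trees is a non-identity automorphism, so such trees have at least
`m` vertices (`IsParentMap.isSpread`). By induction, a descendant tree with `κ` vertices has at
least `2 ^ κ` types of sibling-rigid colourings (`IsSpread.exists_isTypeCode`): a child with an
isomorphic sibling has at least `2 ^ m` types, enough to share them out among at most `2 ^ m`
siblings without loss of cardinality.

Climbing the ray from `v`, the new branches avoid the type of the branch containing `v`. Every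
subset of `V` is thus encoded by an asymmetrizing set from which it can be recovered up to
automorphisms fixing `v` (`IsSpread.exists_rigid_family`). Automorphisms send `v` to at most `#V`
places, so each equivalence class contains at most `#V` of these `2 ^ #V` sets, which forces `2 ^
#V` classes. -/

/-- The descendants of `x`, including `x`, with respect to the parent map `p`. -/
def descendants (p : V → V) (x : V) : Set V := {z | ∃ n : ℕ, p^[n] z = x}

/-- The descendant trees of `x` and `y`, coloured by `S` and `S'`, are isomorphic. -/
inductive ColorIso (p : V → V) (S S' : Set V) : V → V → Prop
  | mk {x y : V} (hc : x ∈ S ↔ y ∈ S') (e : {z // p z = x} ≃ {z // p z = y})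
      (h : ∀ z, ColorIso p S S' z.1 (e z).1) : ColorIso p S S' x y

/-! ### Descendant trees of a well-founded parent map and their isomorphisms -/

section Genealogy

variable {p : V → V}

theorem self_mem_descendants (x : V) : x ∈ descendants p x := ⟨0, rfl⟩

theorem mem_descendants_parent {x z : V} (h : z ∈ descendants p x) : z ∈ descendants p (p x) := by
  obtain ⟨n, rfl⟩ := h
  exact ⟨n + 1, Function.iterate_succ_apply' p n z⟩

theorem mem_descendants_of_parent {x z : V} (h : p z ∈ descendants p x) : z ∈ descendants p x := by
  obtain ⟨n, rfl⟩ := h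
  exact ⟨n + 1, rfl⟩

theorem mem_descendants_trans {x y z : V} (h : z ∈ descendants p y) (h' : y ∈ descendants p x) :
    z ∈ descendants p x := by
  obtain ⟨n, rfl⟩ := h
  obtain ⟨k, rfl⟩ := h'
  exact ⟨k + n, Function.iterate_add_apply p k n z⟩

theorem eq_or_parent_mem {x z : V} (h : z ∈ descendants p x) : z = x ∨ p z ∈ descendants p x := by
  obtain ⟨n, h⟩ := h
  cases n with
  | zero => exact Or.inl h
  | succ n => exact Or.inr ⟨n, h⟩

theorem eq_or_mem_child {x z : V} (h : z ∈ descendants p x) :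
    z = x ∨ ∃ y, p y = x ∧ z ∈ descendants p y := by
  obtain ⟨n, h⟩ := h
  cases n with
  | zero => exact Or.inl h
  | succ n => exact Or.inr ⟨p^[n] z, by rw [← Function.iterate_succ_apply' p n z]; exact h, n, rfl⟩

theorem transGen_iterate (n : ℕ) (z : V) :
    Relation.TransGen (fun y x => p y = x) z (p^[n + 1] z) := by
  induction n with
  | zero => exact .single rfl
  | succ n ih => exact ih.tail (Function.iterate_succ_apply' p (n + 1) z).symm

theorem iterate_succ_ne (hwf : WellFounded fun y x => p y = x) (n : ℕ) (z : V) :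
    p^[n + 1] z ≠ z := by
  intro h
  have := transGen_iterate (p := p) n z
  rw [h] at this
  exact hwf.transGen.irrefl.irrefl z this

theorem iterate_injective (hwf : WellFounded fun y x => p y = x) (z : V) :
    Function.Injective fun n => p^[n] z := by
  have key : ∀ n k : ℕ, p^[n + k + 1] z ≠ p^[n] z := by
    intro n k h
    apply iterate_succ_ne hwf k (p^[n] z)
    rw [← Function.iterate_add_apply, Nat.add_comm (k + 1) n]
    exact h
  intro a b h
  rcases lt_trichotomy a b with hab | hab | hab
  · obtain ⟨k, rfl⟩ := Nat.exists_eq_add_of_lt hab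
    exact absurd h.symm (key a k)
  · exact hab
  · obtain ⟨k, rfl⟩ := Nat.exists_eq_add_of_lt hab
    exact absurd h (key b k)

theorem parent_notMem (hwf : WellFounded fun y x => p y = x) (x : V) :
    p x ∉ descendants p x := by
  rintro ⟨n, h⟩
  exact iterate_succ_ne hwf n x h

theorem child_unique (hwf : WellFounded fun y x => p y = x) {y y' z : V} (h : p y = p y')
    (hz : z ∈ descendants p y) (hz' : z ∈ descendants p y') : y = y' := by
  obtain ⟨n, rfl⟩ := hz
  obtain ⟨k, rfl⟩ := hz'
  rw [← Function.iterate_succ_apply' p, ← Function.iterate_succ_apply' p] at h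
  have := iterate_injective hwf z h
  simp only [Nat.add_right_cancel_iff, Nat.succ_eq_add_one] at this
  rw [this]

/-- Sibling descendant trees are disjoint and miss their parent, so colours can be prescribed on
them independently. -/
theorem exists_glued_set (hwf : WellFounded fun y x => p y = x) (x : V) (ε : Prop)
    (F : V → Set V) : ∃ S : Set V, (x ∈ S ↔ ε) ∧
      ∀ y, p y = x → ∀ z ∈ descendants p y, (z ∈ S ↔ z ∈ F y) := by
  refine ⟨{z | (z = x ∧ ε) ∨ ∃ y, p y = x ∧ z ∈ descendants p y ∧ z ∈ F y}, ?_, ?_⟩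
  · constructor
    · rintro (h | ⟨y, rfl, h, -⟩)
      · exact h.2
      · exact absurd h (parent_notMem hwf y)
    · exact fun h => Or.inl ⟨rfl, h⟩
  · rintro y rfl z hz
    constructor
    · rintro (h | ⟨y', h, hz', h'⟩)
      · exact absurd (h.1 ▸ hz) (parent_notMem hwf y)
      · rwa [child_unique hwf h hz' hz] at h'
    · exact fun h => Or.inr ⟨y, rfl, hz, h⟩

namespace ColorIso

theorem refl (hwf : WellFounded fun y x => p y = x) {S S' : Set V} (x : V)
    (h : ∀ z ∈ descendants p x, (z ∈ S ↔ z ∈ S')) : ColorIso p S S' x x := by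
  induction x using hwf.induction with
  | _ x ih =>
    refine .mk (h x (self_mem_descendants x)) (Equiv.refl _) fun z => ih z.1 z.2 fun w hw => ?_
    exact h w (z.2 ▸ mem_descendants_parent hw)

theorem symm {S S' : Set V} {x y : V} (h : ColorIso p S S' x y) : ColorIso p S' S y x := by
  induction h with
  | mk hc e _ ih =>
    refine .mk hc.symm e.symm fun z => ?_
    have := ih (e.symm z)
    rwa [e.apply_symm_apply] at this

theorem trans {S S' S'' : Set V} {x y z : V} (h : ColorIso p S S' x y)
    (h' : ColorIso p S' S'' y z) : ColorIso p S S'' x z := by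
  induction h generalizing z with
  | mk hc e _ ih =>
    cases h' with
    | mk hc' e' h' => exact .mk (hc.trans hc') (e.trans e') fun w => ih w (h' (e w))

theorem forget {S S' : Set V} {x y : V} (h : ColorIso p S S' x y) : ColorIso p ∅ ∅ x y := by
  induction h with
  | mk hc e _ ih => exact .mk Iff.rfl e ih

theorem exists_pullback (hwf : WellFounded fun y x => p y = x) {x y : V}
    (h : ColorIso p ∅ ∅ x y) (S' : Set V) : ∃ S, ColorIso p S S' x y := by
  induction h with
  | @mk x y hc e _ ih =>
    choose F hF using ih
    classical
    obtain ⟨S, hS, hSF⟩ := exists_glued_set hwf x (y ∈ S')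
      fun z => if hz : p z = x then F ⟨z, hz⟩ else ∅
    refine ⟨S, .mk hS e fun z => (refl hwf z.1 fun w hw => ?_).trans (hF z)⟩
    have := hSF z.1 z.2 w hw
    rwa [dif_pos z.2] at this

/-- An isomorphism of descendant trees is realized by mutually inverse maps. -/
theorem exists_maps (hwf : WellFounded fun y x => p y = x) {x y : V}
    (h : ColorIso p ∅ ∅ x y) : ∃ f g : V → V, f x = y ∧ g y = x ∧
      (∀ z ∈ descendants p x, f z ∈ descendants p y ∧ g (f z) = z) ∧
      (∀ z ∈ descendants p y, g z ∈ descendants p x ∧ f (g z) = z) ∧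
      (∀ z ∈ descendants p x, z ≠ x → p (f z) = f (p z)) := by
  induction h with
  | @mk x y _ e _ ih =>
    choose F G hF hG hFD hGD hFp using ih
    classical
    -- A proper descendant of `x` lies below exactly one child, where the map from the induction
    -- hypothesis is used; the default value serves the root.
    let f : V → V := fun z =>
      if h : ∃ c : {c // p c = x}, z ∈ descendants p c.1 then F h.choose z else y
    let g : V → V := fun z =>
      if h : ∃ c : {c // p c = x}, z ∈ descendants p (e c).1 then G h.choose z else x
    have hf : ∀ c : {c // p c = x}, ∀ z ∈ descendants p c.1, f z = F c z := by
      intro c z hz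
      have h : ∃ c : {c // p c = x}, z ∈ descendants p c.1 := ⟨c, hz⟩
      have hc : h.choose = c :=
        Subtype.ext (child_unique hwf (h.choose.2.trans c.2.symm) h.choose_spec hz)
      simp only [f, dif_pos h, hc]
    have hg : ∀ c : {c // p c = x}, ∀ z ∈ descendants p (e c).1, g z = G c z := by
      intro c z hz
      have h : ∃ c : {c // p c = x}, z ∈ descendants p (e c).1 := ⟨c, hz⟩
      have hc : h.choose = c := e.injective
        (Subtype.ext (child_unique hwf ((e _).2.trans (e c).2.symm) h.choose_spec hz))
      simp only [g, dif_pos h, hc]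
    have hfx : f x = y := dif_neg fun ⟨c, hc⟩ => parent_notMem hwf c.1 (c.2.symm ▸ hc)
    have hgy : g y = x := dif_neg fun ⟨c, hc⟩ => parent_notMem hwf (e c).1 ((e c).2.symm ▸ hc)
    refine ⟨f, g, hfx, hgy, fun z hz => ?_, fun z hz => ?_, fun z hz hne => ?_⟩
    · rcases eq_or_mem_child hz with rfl | ⟨c, hc, hz⟩
      · exact ⟨hfx ▸ self_mem_descendants _, by rw [hfx, hgy]⟩
      · obtain ⟨h1, h2⟩ := hFD ⟨c, hc⟩ z hz
        rw [hf ⟨c, hc⟩ z hz, hg ⟨c, hc⟩ _ h1]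
        exact ⟨(e ⟨c, hc⟩).2 ▸ mem_descendants_parent h1, h2⟩
    · rcases eq_or_mem_child hz with rfl | ⟨c, hc, hz⟩
      · exact ⟨hgy ▸ self_mem_descendants _, by rw [hgy, hfx]⟩
      · obtain ⟨d, hd⟩ := e.surjective ⟨c, hc⟩
        have hz' : z ∈ descendants p (e d).1 := by rw [hd]; exact hz
        obtain ⟨h1, h2⟩ := hGD d z hz'
        rw [hg d z hz', hf d _ h1]
        exact ⟨d.2 ▸ mem_descendants_parent h1, h2⟩
    · rcases eq_or_mem_child hz with rfl | ⟨c, hc, hz⟩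
      · exact absurd rfl hne
      · rcases eq_or_parent_mem hz with rfl | hpz
        · rw [hf ⟨z, hc⟩ z hz, hF, hc, hfx]
          exact (e ⟨z, hc⟩).2
        · rw [hf ⟨c, hc⟩ z hz, hf ⟨c, hc⟩ _ hpz]
          refine hFp ⟨c, hc⟩ z hz ?_
          rintro rfl
          exact parent_notMem hwf z hpz

end ColorIso

/-- Swapping two isomorphic sibling descendant trees. -/
theorem exists_swap (hwf : WellFounded fun y x => p y = x) {x y : V} (hxy : x ≠ y)
    (hp : p x = p y) (h : ColorIso p ∅ ∅ x y) : ∃ σ : V → V, (∀ z, σ (σ z) = z) ∧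
      (∀ z, p (σ z) = σ (p z)) ∧ σ x ≠ x ∧
      (∀ z, σ z ≠ z → z ∈ descendants p x ∪ descendants p y) := by
  classical
  obtain ⟨f, g, hfx, hgy, hf, hg, hfp⟩ := h.exists_maps hwf
  have hgp : ∀ z ∈ descendants p y, z ≠ y → p (g z) = g (p z) := by
    intro z hz hne
    have hne' : g z ≠ x := fun h' => hne (by rw [← (hg z hz).2, h', hfx])
    have h1 := hfp (g z) (hg z hz).1 hne'
    rw [(hg z hz).2] at h1
    rw [h1, (hf _ ((eq_or_parent_mem (hg z hz).1).resolve_left hne')).2]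
  have hdisj : ∀ z ∈ descendants p y, z ∉ descendants p x :=
    fun z h1 h2 => hxy (child_unique hwf hp h2 h1)
  let σ : V → V := fun z =>
    if z ∈ descendants p x then f z else if z ∈ descendants p y then g z else z
  have σx : ∀ z ∈ descendants p x, σ z = f z := fun z hz => if_pos hz
  have σy : ∀ z ∈ descendants p y, σ z = g z := fun z hz =>
    (if_neg (hdisj z hz)).trans (if_pos hz)
  have σn : ∀ z, z ∉ descendants p x → z ∉ descendants p y → σ z = z := fun z h1 h2 =>
    (if_neg h1).trans (if_neg h2)
  have hpx : σ (p x) = p x :=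
    σn _ (parent_notMem hwf x) (hp ▸ parent_notMem hwf y)
  refine ⟨σ, fun z => ?_, fun z => ?_, ?_, fun z hz => ?_⟩
  · by_cases h1 : z ∈ descendants p x
    · rw [σx z h1, σy _ (hf z h1).1, (hf z h1).2]
    · by_cases h2 : z ∈ descendants p y
      · rw [σy z h2, σx _ (hg z h2).1, (hg z h2).2]
      · rw [σn z h1 h2, σn z h1 h2]
  · by_cases h1 : z ∈ descendants p x
    · rcases eq_or_parent_mem h1 with rfl | h3
      · rw [hpx, σx z h1, hfx, hp]
      · rw [σx z h1, σx _ h3, hfp z h1]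
        rintro rfl
        exact parent_notMem hwf z h3
    · by_cases h2 : z ∈ descendants p y
      · rcases eq_or_parent_mem h2 with rfl | h3
        · rw [← hp, hpx, σy z h2, hgy]
        · rw [σy z h2, σy _ h3, hgp z h2]
          rintro rfl
          exact parent_notMem hwf z h3
      · rw [σn z h1 h2, σn _ (fun h => h1 (mem_descendants_of_parent h))
          (fun h => h2 (mem_descendants_of_parent h))]
  · rw [σx x (self_mem_descendants x), hfx]
    exact hxy.symm
  · by_contra h
    exact hz (σn z (fun h' => h (Or.inl h')) (fun h' => h (Or.inr h')))

theorem ColorIso.mk_descendants_eq (hwf : WellFounded fun y x => p y = x) {x y : V}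
    (h : ColorIso p ∅ ∅ x y) : #(descendants p x) = #(descendants p y) := by
  obtain ⟨f, g, -, -, hf, hg, -⟩ := h.exists_maps hwf
  exact Cardinal.mk_congr
    ⟨fun z => ⟨f z, (hf z z.2).1⟩, fun z => ⟨g z, (hg z z.2).1⟩,
      fun z => Subtype.ext (hf z z.2).2, fun z => Subtype.ext (hg z z.2).2⟩

end Genealogy

/-! ### Sibling-rigid colourings: counting types and climbing a line of ancestors -/

section Types

variable {p : V → V}

/-- No two distinct siblings strictly below `x` have isomorphic coloured descendant trees. -/
def SiblingRigid (p : V → V) (S : Set V) (x : V) : Prop :=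
  ∀ z ∈ descendants p x, ∀ a b, p a = z → p b = z → ColorIso p S S a b → a = b

theorem SiblingRigid.of_mem {S : Set V} {x y : V} (h : SiblingRigid p S x)
    (hy : y ∈ descendants p x) : SiblingRigid p S y :=
  fun z hz => h z (mem_descendants_trans hz hy)

theorem SiblingRigid.congr (hwf : WellFounded fun y x => p y = x) {S S' : Set V} {x : V}
    (h : SiblingRigid p S x) (hS : ∀ z ∈ descendants p x, (z ∈ S' ↔ z ∈ S)) :
    SiblingRigid p S' x := by
  intro z hz a b ha hb hab
  have key : ∀ c, p c = z → ColorIso p S S' c c := fun c hc => .refl hwf c fun w hw =>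
    (hS w (mem_descendants_trans hw (mem_descendants_of_parent (hc.symm ▸ hz)))).symm
  exact h z hz a b ha hb (((key a ha).trans hab).trans (key b hb).symm)

theorem SiblingRigid.of_children {S : Set V} {x : V}
    (h : ∀ a b, p a = x → p b = x → ColorIso p S S a b → a = b)
    (h' : ∀ y, p y = x → SiblingRigid p S y) : SiblingRigid p S x := by
  intro z hz
  rcases eq_or_mem_child hz with rfl | ⟨y, hy, hz⟩
  · exact h
  · exact h' y hy z hz

theorem SiblingRigid.of_colorIso {S S' : Set V} {x y : V} (h : ColorIso p S S' x y)
    (hy : SiblingRigid p S' y) : SiblingRigid p S x := by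
  induction h with
  | @mk x y _ e h ih =>
    refine .of_children (fun a b ha hb hab => ?_) fun a ha => ?_
    · have := hy y (self_mem_descendants y) _ _ (e ⟨a, ha⟩).2 (e ⟨b, hb⟩).2
        (((h ⟨a, ha⟩).symm.trans hab).trans (h ⟨b, hb⟩))
      exact congrArg Subtype.val (e.injective (Subtype.ext this))
    · refine ih ⟨a, ha⟩ (hy.of_mem ?_)
      exact ⟨1, (e ⟨a, ha⟩).2⟩

/-- Isomorphism of coloured descendant trees, as an equivalence of pairs of a root and a colour
class. -/
def typeSetoid (hwf : WellFounded fun y x => p y = x) : Setoid (V × Set V) where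
  r a b := ColorIso p a.2 b.2 a.1 b.1
  iseqv := ⟨fun a => .refl hwf a.1 fun _ _ => Iff.rfl, ColorIso.symm, ColorIso.trans⟩

/-- Isomorphism types of coloured descendant trees. -/
abbrev ColorType (hwf : WellFounded fun y x => p y = x) : Type u := Quotient (typeSetoid hwf)

/-- The isomorphism type of the descendant tree of `x` coloured by `S`. -/
def colorType (hwf : WellFounded fun y x => p y = x) (S : Set V) (x : V) : ColorType hwf :=
  Quotient.mk (typeSetoid hwf) (x, S)

theorem colorType_eq_iff (hwf : WellFounded fun y x => p y = x) {S S' : Set V} {x y : V} :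
    colorType hwf S x = colorType hwf S' y ↔ ColorIso p S S' x y :=
  Quotient.eq (r := typeSetoid hwf)

theorem colorType_congr (hwf : WellFounded fun y x => p y = x) {S S' : Set V} {x : V}
    (h : ∀ z ∈ descendants p x, (z ∈ S ↔ z ∈ S')) : colorType hwf S x = colorType hwf S' x :=
  (colorType_eq_iff hwf).2 (.refl hwf x h)

/-- The types of the sibling-rigid colourings of the descendant tree of `x`. -/
def rigidTypes (hwf : WellFounded fun y x => p y = x) (x : V) : Set (ColorType hwf) :=
  {t | ∃ S, SiblingRigid p S x ∧ colorType hwf S x = t}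

theorem rigidTypes_subset (hwf : WellFounded fun y x => p y = x) {x y : V}
    (h : ColorIso p ∅ ∅ x y) : rigidTypes hwf y ⊆ rigidTypes hwf x := by
  rintro _ ⟨S', hS', rfl⟩
  obtain ⟨S, hS⟩ := h.exists_pullback hwf S'
  exact ⟨S, hS'.of_colorIso hS, (colorType_eq_iff hwf).2 hS⟩

theorem rigidTypes_eq (hwf : WellFounded fun y x => p y = x) {x y : V}
    (h : ColorIso p ∅ ∅ x y) : rigidTypes hwf x = rigidTypes hwf y :=
  (rigidTypes_subset hwf h.symm).antisymm (rigidTypes_subset hwf h)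

theorem colorIso_of_mem_rigidTypes (hwf : WellFounded fun y x => p y = x) {x y : V}
    {t : ColorType hwf} (hx : t ∈ rigidTypes hwf x) (hy : t ∈ rigidTypes hwf y) :
    ColorIso p ∅ ∅ x y := by
  obtain ⟨S, -, rfl⟩ := hx
  obtain ⟨S', -, h⟩ := hy
  exact ((colorType_eq_iff hwf).1 h).symm.forget

/-- Distinct types for the children of `x` can be realized simultaneously. -/
theorem exists_realization (hwf : WellFounded fun y x => p y = x) (x : V) (ε : Prop)
    (F : V → Set V) (hF : ∀ y, p y = x → SiblingRigid p (F y) y)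
    (hinj : ∀ y y', p y = x → p y' = x →
      colorType hwf (F y) y = colorType hwf (F y') y' → y = y') :
    ∃ S, SiblingRigid p S x ∧ (x ∈ S ↔ ε) ∧
      ∀ y, p y = x → ∀ z ∈ descendants p y, (z ∈ S ↔ z ∈ F y) := by
  obtain ⟨S, hS, hSF⟩ := exists_glued_set hwf x ε F
  refine ⟨S, .of_children (fun a b ha hb hab => hinj a b ha hb ?_)
    fun y hy => (hF y hy).congr hwf (hSF y hy), hS, hSF⟩
  rw [← colorType_congr hwf (hSF a ha), ← colorType_congr hwf (hSF b hb)]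
  exact (colorType_eq_iff hwf).2 hab

/-- Isomorphic coloured descendant trees have the same types of children. -/
theorem ColorIso.exists_child (hwf : WellFounded fun y x => p y = x) {S S' : Set V} {x x' : V}
    (h : ColorIso p S S' x x') {y : V} (hy : p y = x) :
    ∃ y', p y' = x' ∧ colorType hwf S y = colorType hwf S' y' := by
  cases h with
  | mk _ e h => exact ⟨_, (e ⟨y, hy⟩).2, (colorType_eq_iff hwf).2 (h ⟨y, hy⟩)⟩

theorem ColorIso.mem_iff {S S' : Set V} {x x' : V}
    (h : ColorIso p S S' x x') : x ∈ S ↔ x' ∈ S' := by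
  cases h with
  | mk hc _ _ => exact hc

/-- `c` encodes the subsets of the descendant tree of `x` by types of sibling-rigid colourings. -/
def IsTypeCode (hwf : WellFounded fun y x => p y = x) (x : V) (c : Set V → ColorType hwf) : Prop :=
  (∀ A, c A ∈ rigidTypes hwf x) ∧
    ∀ A A', c A = c A' → ∀ z ∈ descendants p x, (z ∈ A ↔ z ∈ A')

theorem IsTypeCode.two_power_le (hwf : WellFounded fun y x => p y = x) {x : V}
    {c : Set V → ColorType hwf} (hc : IsTypeCode hwf x c) :
    2 ^ #(descendants p x) ≤ #(rigidTypes hwf x) := by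
  rw [← Cardinal.mk_set]
  refine Cardinal.mk_le_of_injective
    (f := fun A : Set (descendants p x) => ⟨c (Subtype.val '' A), hc.1 _⟩) fun A A' h => ?_
  ext z
  have := hc.2 _ _ (congrArg Subtype.val h) z.1 z.2
  simpa using this

/-- The combinatorial content of the motion and degree conditions on `p`. -/
structure IsSpread (p : V → V) (m : Cardinal.{u}) : Prop where
  wf : WellFounded fun y x => p y = x
  infinite : ℵ₀ ≤ m
  le_descendants : ∀ x y, x ≠ y → p x = p y → ColorIso p ∅ ∅ x y → m ≤ #(descendants p x)
  children_le : ∀ x, #{y // p y = x} ≤ 2 ^ m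

/-- Infinite cardinal arithmetic: `#α * #K ≤ #K`, and removing at most one point keeps the
cardinality of `K`. In use, `K` is the set of types at a child, `α` the set of its siblings (itself
included), and `B` a forbidden type. -/
theorem exists_injection_diff {α κ : Type u} {K B : Set κ} (hK : ℵ₀ ≤ #K) (hα : #α ≤ #K)
    (hB : B.Subsingleton) : ∃ j : α → κ → κ, (∀ a, ∀ k ∈ K, j a k ∈ K \ B) ∧
      ∀ a a', ∀ k ∈ K, ∀ k' ∈ K, j a k = j a' k' → a = a' ∧ k = k' := by
  have hlt : #B < ℵ₀ := Cardinal.lt_aleph0_iff_set_finite.2 hB.finite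
  have h1 : #K ≤ #(K \ B : Set κ) := by
    have h2 : #K ≤ #(K \ B : Set κ) + #B := by
      refine (Cardinal.mk_le_mk_of_subset ?_).trans (Cardinal.mk_union_le (K \ B) B)
      rw [Set.sdiff_union_self]
      exact Set.subset_union_left
    by_contra h3
    exact (h2.trans_lt (Cardinal.add_lt_of_lt hK (not_le.1 h3) (hlt.trans_le hK))).false
  have h2 : #(α × K) ≤ #(K \ B : Set κ) := by
    rw [Cardinal.mk_prod, Cardinal.lift_id, Cardinal.lift_id]
    exact ((mul_le_mul_left hα _).trans (Cardinal.mul_eq_self hK).le).trans h1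
  obtain ⟨f⟩ := Cardinal.le_def _ _ |>.1 h2
  classical
  refine ⟨fun a k => if hk : k ∈ K then f (a, ⟨k, hk⟩) else k, fun a k hk => ?_,
    fun a a' k hk k' hk' h => ?_⟩
  · simp only [dif_pos hk]
    exact (f (a, ⟨k, hk⟩)).2
  · simp only [dif_pos hk, dif_pos hk'] at h
    have := f.injective (Subtype.ext h)
    simpa using this

/-- Subsets of the descendant trees of the children `Y` of `x` are encoded by sets of types that
are distinct for distinct children and avoid `B`. -/
theorem IsSpread.exists_child_types {m : Cardinal.{u}} (hp : IsSpread p m) (x : V) (Y : Set V)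
    (hY : ∀ y ∈ Y, p y = x) (B : Set (ColorType hp.wf)) (hB : B.Subsingleton)
    (hYB : ∀ y ∈ Y, ∀ t ∈ B, t ∈ rigidTypes hp.wf y →
      ∃ y', y' ≠ y ∧ p y' = x ∧ ColorIso p ∅ ∅ y y')
    (hc : ∀ y ∈ Y, ∃ c, IsTypeCode hp.wf y c) :
    ∃ θ : Set V → V → ColorType hp.wf, (∀ A, ∀ y ∈ Y, θ A y ∈ rigidTypes hp.wf y \ B) ∧
      ∀ A A', ∀ y ∈ Y, ∀ y' ∈ Y, θ A y = θ A' y' →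
        y = y' ∧ ∀ z ∈ descendants p y, (z ∈ A ↔ z ∈ A') := by
  classical
  have : Nonempty (Set V → ColorType hp.wf) := ⟨fun _ => colorType hp.wf ∅ x⟩
  choose! c hc using hc
  -- A child with an isomorphic sibling has at least `m` descendants, hence at least `2 ^ m` types:
  -- room for a copy of all its types for each child of `x`.
  have hex : ∀ y ∈ Y, (∃ y', y' ≠ y ∧ p y' = x ∧ ColorIso p ∅ ∅ y y') →
      ∃ j : {y // p y = x} → ColorType hp.wf → ColorType hp.wf,
        (∀ a, ∀ k ∈ rigidTypes hp.wf y, j a k ∈ rigidTypes hp.wf y \ B) ∧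
        ∀ a a', ∀ k ∈ rigidTypes hp.wf y, ∀ k' ∈ rigidTypes hp.wf y,
          j a k = j a' k' → a = a' ∧ k = k' := by
    rintro y hy ⟨y', hne, hy', hiso⟩
    have h1 := hp.le_descendants y y' hne.symm ((hY y hy).trans hy'.symm) hiso
    have h2 : (2 : Cardinal.{u}) ^ m ≤ #(rigidTypes hp.wf y) :=
      (Cardinal.power_le_power_left two_ne_zero h1).trans ((hc y hy).two_power_le hp.wf)
    exact exists_injection_diff (hp.infinite.trans ((Cardinal.cantor m).le.trans h2))
      ((hp.children_le x).trans h2) hB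
  let P : Set (ColorType hp.wf) → ({y // p y = x} → ColorType hp.wf → ColorType hp.wf) → Prop :=
    fun K j => (∀ a, ∀ k ∈ K, j a k ∈ K \ B) ∧
        ∀ a a', ∀ k ∈ K, ∀ k' ∈ K, j a k = j a' k' → a = a' ∧ k = k'
  -- The injection is chosen from the set of types rather than from the child, so isomorphic
  -- siblings share it and its first argument separates them.
  let J : Set (ColorType hp.wf) → {y // p y = x} → ColorType hp.wf → ColorType hp.wf :=
    fun K => if h : ∃ j, P K j then h.choose else fun _ k => k
  have hJ : ∀ y ∈ Y, (∃ y', y' ≠ y ∧ p y' = x ∧ ColorIso p ∅ ∅ y y') →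
      P (rigidTypes hp.wf y) (J (rigidTypes hp.wf y)) := by
    intro y hy h
    have h' : ∃ j, P (rigidTypes hp.wf y) j := hex y hy h
    simp only [J, dif_pos h']
    exact h'.choose_spec
  -- A child without isomorphic siblings may have few types, but keeps its code: no sibling can
  -- share its type, and `hYB` keeps it out of `B`.
  let θ : Set V → V → ColorType hp.wf := fun A y =>
    if h : p y = x ∧ ∃ y', y' ≠ y ∧ p y' = x ∧ ColorIso p ∅ ∅ y y' then
      J (rigidTypes hp.wf y) ⟨y, h.1⟩ (c y A) else c y A
  have hθ : ∀ A, ∀ y ∈ Y, θ A y ∈ rigidTypes hp.wf y \ B := by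
    intro A y hy
    by_cases h : ∃ y', y' ≠ y ∧ p y' = x ∧ ColorIso p ∅ ∅ y y'
    · simp only [θ, dif_pos (And.intro (hY y hy) h)]
      exact (hJ y hy h).1 _ _ ((hc y hy).1 A)
    · simp only [θ, dif_neg (fun h' : p y = x ∧ _ => h h'.2)]
      exact ⟨(hc y hy).1 A, fun hA => h (hYB y hy _ hA ((hc y hy).1 A))⟩
  refine ⟨θ, hθ, fun A A' y hy y' hy' h => ?_⟩
  have hiso : ColorIso p ∅ ∅ y y' :=
    colorIso_of_mem_rigidTypes hp.wf (hθ A y hy).1 (h ▸ (hθ A' y' hy').1)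
  by_cases hs : ∃ y', y' ≠ y ∧ p y' = x ∧ ColorIso p ∅ ∅ y y'
  · have hs' : ∃ z, z ≠ y' ∧ p z = x ∧ ColorIso p ∅ ∅ y' z := by
      by_cases hyy : y = y'
      · exact hyy ▸ hs
      · exact ⟨y, hyy, hY y hy, hiso.symm⟩
    simp only [θ, dif_pos (And.intro (hY y hy) hs), dif_pos (And.intro (hY y' hy') hs')] at h
    rw [← rigidTypes_eq hp.wf hiso] at h
    obtain ⟨h1, h2⟩ := (hJ y hy hs).2 _ _ _ ((hc y hy).1 A) _
      (by rw [rigidTypes_eq hp.wf hiso]; exact (hc y' hy').1 A') h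
    obtain rfl : y = y' := congrArg Subtype.val h1
    exact ⟨rfl, (hc y hy).2 A A' h2⟩
  · obtain rfl : y = y' := by
      by_contra hne
      exact hs ⟨y', fun h => hne h.symm, hY y' hy', hiso⟩
    simp only [θ, dif_neg (fun h' : p y = x ∧ _ => hs h'.2)] at h
    exact ⟨rfl, (hc y hy).2 A A' h⟩

/-- The colour of `x` stores whether `x ∈ A`, and the types of the children store the rest. Types of
distinct children differ even for different `A`, so an isomorphism must match each child with
itself, and `A` can be read off. -/
theorem IsSpread.exists_isTypeCode {m : Cardinal.{u}} (hp : IsSpread p m) (x : V) :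
    ∃ c, IsTypeCode hp.wf x c := by
  induction x using hp.wf.induction with
  | _ x ih =>
    obtain ⟨θ, hθ, hinj⟩ := hp.exists_child_types x {y | p y = x} (fun _ h => h) ∅
      Set.subsingleton_empty (fun _ _ _ h => absurd h (Set.notMem_empty _)) ih
    have hS : ∀ A, ∃ S, SiblingRigid p S x ∧ (x ∈ S ↔ x ∈ A) ∧
        ∀ y, p y = x → colorType hp.wf S y = θ A y := by
      intro A
      have h1 : ∀ y, ∃ S, p y = x → SiblingRigid p S y ∧ colorType hp.wf S y = θ A y := by
        intro y
        by_cases hy : p y = x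
        · obtain ⟨S, hS⟩ := (hθ A y hy).1
          exact ⟨S, fun _ => hS⟩
        · exact ⟨∅, fun h => absurd h hy⟩
      choose F hF using h1
      obtain ⟨S, hS, hxS, hSF⟩ := exists_realization hp.wf x (x ∈ A) F (fun y hy => (hF y hy).1)
        fun y y' hy hy' h => by
          rw [(hF y hy).2, (hF y' hy').2] at h
          exact (hinj A A y hy y' hy' h).1
      exact ⟨S, hS, hxS, fun y hy => (colorType_congr hp.wf (hSF y hy)).trans (hF y hy).2⟩
    choose F hF hxF hFθ using hS
    refine ⟨fun A => colorType hp.wf (F A) x, fun A => ⟨F A, hF A, rfl⟩, fun A A' h z hz => ?_⟩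
    rw [colorType_eq_iff] at h
    rcases eq_or_mem_child hz with rfl | ⟨y, hy, hz⟩
    · exact (hxF A).symm.trans (h.mem_iff.trans (hxF A'))
    · obtain ⟨y', hy', he⟩ := h.exists_child hp.wf hy
      rw [hFθ A y hy, hFθ A' y' hy'] at he
      exact (hinj A A' y hy y' hy' he).2 z hz

/-- Extending a sibling-rigid colouring from the descendant tree of `v` to that of its parent. -/
theorem IsSpread.exists_extension {m : Cardinal.{u}} (hp : IsSpread p m) (v : V) :
    ∃ E : Set V → Set V → Set V,
      (∀ A S, SiblingRigid p S v → SiblingRigid p (E A S) (p v) ∧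
        ∀ z ∈ descendants p v, (z ∈ E A S ↔ z ∈ S)) ∧
      ∀ A A' S S', SiblingRigid p S v → SiblingRigid p S' v → ColorIso p S S' v v →
        ColorIso p (E A S) (E A' S') (p v) (p v) →
        ∀ z ∈ descendants p (p v), z ∉ descendants p v → (z ∈ A ↔ z ∈ A') := by
  classical
  -- Here `t` is the type of the branch at `v`, forbidden to its siblings. A sibling that could
  -- realize `t` is isomorphic to `v`, so it has room to avoid it.
  have hθ : ∀ t : ColorType hp.wf, ∃ θ : Set V → V → ColorType hp.wf, t ∈ rigidTypes hp.wf v →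
      (∀ A, ∀ y, p y = p v → y ≠ v → θ A y ∈ rigidTypes hp.wf y ∧ θ A y ≠ t) ∧
      ∀ A A' y y', p y = p v → y ≠ v → p y' = p v → y' ≠ v → θ A y = θ A' y' →
        y = y' ∧ ∀ z ∈ descendants p y, (z ∈ A ↔ z ∈ A') := by
    intro t
    by_cases ht : t ∈ rigidTypes hp.wf v
    · obtain ⟨θ, hθ, hinj⟩ := hp.exists_child_types (p v) {y | p y = p v ∧ y ≠ v} (fun _ h => h.1)
        {t} Set.subsingleton_singleton
        (fun y hy t' ht' hty => ⟨v, hy.2.symm, rfl, colorIso_of_mem_rigidTypes hp.wf hty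
          ((Set.mem_singleton_iff.1 ht').symm ▸ ht)⟩)
        fun y _ => hp.exists_isTypeCode y
      exact ⟨θ, fun _ => ⟨fun A y h1 h2 => hθ A y ⟨h1, h2⟩,
        fun A A' y y' h1 h2 h3 h4 => hinj A A' y ⟨h1, h2⟩ y' ⟨h3, h4⟩⟩⟩
    · exact ⟨fun _ _ => t, fun h => absurd h ht⟩
  choose θ hθ using hθ
  have hE : ∀ A S, ∃ S₁, SiblingRigid p S v → SiblingRigid p S₁ (p v) ∧ (p v ∈ S₁ ↔ p v ∈ A) ∧
      (∀ z ∈ descendants p v, (z ∈ S₁ ↔ z ∈ S)) ∧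
      ∀ y, p y = p v → y ≠ v → colorType hp.wf S₁ y = θ (colorType hp.wf S v) A y := by
    intro A S
    by_cases hS : SiblingRigid p S v
    swap
    · exact ⟨∅, fun h => absurd h hS⟩
    obtain ⟨h1, h2⟩ := hθ (colorType hp.wf S v) ⟨S, hS, rfl⟩
    have h3 : ∀ y, ∃ R, p y = p v → SiblingRigid p R y ∧ (y = v → R = S) ∧
        (y ≠ v → colorType hp.wf R y = θ (colorType hp.wf S v) A y) := by
      intro y
      by_cases hy : y = v
      · exact ⟨S, fun _ => ⟨hy ▸ hS, fun _ => rfl, fun h => absurd hy h⟩⟩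
      · by_cases hpy : p y = p v
        · obtain ⟨R, hR, hR'⟩ := (h1 A y hpy hy).1
          exact ⟨R, fun _ => ⟨hR, fun h => absurd h hy, fun _ => hR'⟩⟩
        · exact ⟨∅, fun h => absurd h hpy⟩
    choose F hF hFv hFθ using h3
    obtain ⟨S₁, hS₁, hv, hSF⟩ := exists_realization hp.wf (p v) (p v ∈ A) F hF
      fun y y' hy hy' h => by
        by_cases e : y = v <;> by_cases e' : y' = v
        · rw [e, e']
        · rw [hFv y hy e, hFθ y' hy' e', e] at h
          exact absurd h.symm (h1 A y' hy' e').2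
        · rw [hFv y' hy' e', hFθ y hy e, e'] at h
          exact absurd h (h1 A y hy e).2
        · rw [hFθ y hy e, hFθ y' hy' e'] at h
          exact (h2 A A y y' hy e hy' e' h).1
    refine ⟨S₁, fun _ => ⟨hS₁, hv, ?_, fun y hy e =>
      (colorType_congr hp.wf (hSF y hy)).trans (hFθ y hy e)⟩⟩
    have := hSF v rfl
    rwa [hFv v rfl rfl] at this
  choose E hE using hE
  refine ⟨E, fun A S hS => ⟨(hE A S hS).1, (hE A S hS).2.2.1⟩,
    fun A A' S S' hS hS' hiso hiso' z hz hzv => ?_⟩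
  obtain ⟨-, h1, h2, h3⟩ := hE A S hS
  obtain ⟨-, h1', h2', h3'⟩ := hE A' S' hS'
  have ht : colorType hp.wf S v = colorType hp.wf S' v := (colorType_eq_iff hp.wf).2 hiso
  obtain ⟨h4, h5⟩ := hθ (colorType hp.wf S v) ⟨S, hS, rfl⟩
  rcases eq_or_mem_child hz with rfl | ⟨y, hy, hz⟩
  · rw [← h1, ← h1', hiso'.mem_iff]
  · have hyv : y ≠ v := by
      intro e
      exact hzv (e ▸ hz)
    obtain ⟨y', hy', he⟩ := hiso'.exists_child hp.wf hy
    rw [h3 y hy hyv] at he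
    -- A branch matched with `v` would have the forbidden type.
    have hyv' : y' ≠ v := by
      rintro rfl
      rw [colorType_congr hp.wf h2', ← ht] at he
      exact (h4 A y hy hyv).2 he
    rw [h3' y' hy' hyv', ← ht] at he
    exact (h5 A A' y y' hy hyv hy' hyv' he).2 z hz

/-- Along a line of ancestors there are as many inequivalent sibling-rigid colourings as there are
sets of vertices. -/
theorem IsSpread.exists_rigid_family {m : Cardinal.{u}} (hp : IsSpread p m) (v : V)
    (hv : ∀ z, ∃ n : ℕ, z ∈ descendants p (p^[n] v)) :
    ∃ F : Set V → Set V, (∀ A n, SiblingRigid p (F A) (p^[n] v)) ∧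
      ∀ A A', (∀ n : ℕ, ColorIso p (F A) (F A') (p^[n] v) (p^[n] v)) → A = A' := by
  obtain ⟨c, hc, hcinj⟩ := hp.exists_isTypeCode v
  choose E hE hEinj using fun w => hp.exists_extension w
  choose R hR hRc using hc
  -- Stage `n` colours the tree below `p^[n] v`. The stages agree where they overlap, and each new
  -- one encodes the part of `A` just reached.
  let Q : Set V → ℕ → Set V := fun A n => Nat.rec (R A) (fun n S => E (p^[n] v) A S) n
  have hQs : ∀ A n, Q A (n + 1) = E (p^[n] v) A (Q A n) := fun A n => rfl
  have hQ : ∀ A n, SiblingRigid p (Q A n) (p^[n] v) := by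
    intro A n
    induction n with
    | zero => exact hR A
    | succ n ih =>
      rw [hQs, Function.iterate_succ_apply']
      exact (hE _ A _ ih).1
  have hmono : ∀ n k z, z ∈ descendants p (p^[n] v) → z ∈ descendants p (p^[n + k] v) := by
    intro n k z hz
    induction k with
    | zero => exact hz
    | succ k ih =>
      rw [← Nat.add_assoc, Function.iterate_succ_apply']
      exact mem_descendants_parent ih
  have hagree : ∀ A n k, ∀ z ∈ descendants p (p^[n] v), (z ∈ Q A (n + k) ↔ z ∈ Q A n) := by
    intro A n k z hz
    induction k with
    | zero => rfl
    | succ k ih =>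
      rw [← ih, ← Nat.add_assoc, hQs]
      exact (hE _ A _ (hQ A (n + k))).2 z (hmono n k z hz)
  let F : Set V → Set V := fun A => {z | ∃ n, z ∈ descendants p (p^[n] v) ∧ z ∈ Q A n}
  have hF : ∀ A n, ∀ z ∈ descendants p (p^[n] v), (z ∈ F A ↔ z ∈ Q A n) := by
    intro A n z hz
    constructor
    · rintro ⟨k, hk, hzk⟩
      rw [← hagree A n k z hz, Nat.add_comm]
      exact (hagree A k n z hk).2 hzk
    · exact fun h => ⟨n, hz, h⟩
  refine ⟨F, fun A n => (hQ A n).congr hp.wf (hF A n), fun A A' h => ?_⟩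
  have hiso : ∀ n, ColorIso p (Q A n) (Q A' n) (p^[n] v) (p^[n] v) := fun n =>
    ((ColorIso.refl hp.wf _ (hF A n)).symm.trans (h n)).trans (.refl hp.wf _ (hF A' n))
  have key : ∀ n, ∀ z ∈ descendants p (p^[n] v), (z ∈ A ↔ z ∈ A') := by
    intro n
    induction n with
    | zero =>
      refine hcinj A A' ?_
      rw [← hRc, ← hRc]
      exact (colorType_eq_iff hp.wf).2 (hiso 0)
    | succ n ih =>
      intro z hz
      by_cases hz' : z ∈ descendants p (p^[n] v)
      · exact ih z hz'
      · have h1 := hiso (n + 1)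
        rw [hQs, hQs, Function.iterate_succ_apply'] at h1
        rw [Function.iterate_succ_apply'] at hz
        exact hEinj _ A A' _ _ (hQ A n) (hQ A' n) (hiso n) h1 z hz hz'
  ext z
  obtain ⟨n, hn⟩ := hv z
  exact key n z hn

end Types

/-! ### Rays in a one-ended tree and the parent map they define -/

section Rays

variable {T : SimpleGraph V}

/-- A ray, i.e. a one-sided infinite path. -/
def IsRay (T : SimpleGraph V) (f : ℕ → V) : Prop :=
  Function.Injective f ∧ ∀ n : ℕ, T.Adj (f n) (f (n + 1))

theorem IsRay.shift {f : ℕ → V} (h : IsRay T f) (k : ℕ) : IsRay T fun n => f (n + k) := by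
  refine ⟨fun a b hab => Nat.add_right_cancel (h.1 hab), fun n => ?_⟩
  have := h.2 (n + k)
  rwa [Nat.add_right_comm] at this

theorem IsRay.map {f : ℕ → V} (h : IsRay T f) (φ : T ≃g T) : IsRay T fun n => φ (f n) :=
  ⟨φ.injective.comp h.1, fun n => φ.map_adj_iff.2 (h.2 n)⟩

theorem IsRay.cons {f : ℕ → V} (h : IsRay T f) {v : V} (hv : T.Adj v (f 0))
    (hne : ∀ n, f n ≠ v) : ∃ g, IsRay T g ∧ g 0 = v ∧ ∀ n, g (n + 1) = f n := by
  refine ⟨fun n => Nat.casesOn n v f, ⟨?_, ?_⟩, rfl, fun _ => rfl⟩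
  · rintro (_ | a) (_ | b) hab
    · rfl
    · exact absurd hab.symm (hne b)
    · exact absurd hab (hne a)
    · exact congrArg _ (h.1 hab)
  · rintro (_ | n)
    · exact hv
    · exact h.2 n

theorem IsRay.exists_walk {f : ℕ → V} (h : IsRay T f) (n : ℕ) :
    ∃ w : T.Walk (f 0) (f n), w.IsPath ∧ (∀ z ∈ w.support, ∃ k, z = f k) ∧
      (n ≠ 0 → w.snd = f 1) ∧ f n ∈ w.support := by
  induction n generalizing f with
  | zero => exact ⟨.nil, by simp, by simp, by simp, by simp⟩
  | succ n ih =>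
    obtain ⟨w, hw, hs, -, -⟩ := ih (h.shift 1)
    refine ⟨.cons (h.2 0) w, ?_, ?_, ?_, ?_⟩
    · rw [SimpleGraph.Walk.cons_isPath_iff]
      refine ⟨hw, fun h0 => ?_⟩
      obtain ⟨k, hk⟩ := hs _ h0
      exact absurd (h.1 hk) (by omega)
    · intro z hz
      rw [SimpleGraph.Walk.support_cons, List.mem_cons] at hz
      rcases hz with rfl | hz
      · exact ⟨0, rfl⟩
      · obtain ⟨k, hk⟩ := hs z hz
        exact ⟨k + 1, hk⟩
    · intro _
      simp
    · simp

theorem IsRay.eq_one_of_adj (hT : T.IsTree) {f : ℕ → V} (h : IsRay T f) {n : ℕ}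
    (hn : T.Adj (f 0) (f n)) : n = 1 := by
  obtain ⟨w, hw, -, h1, hs⟩ := h.exists_walk n
  have hn0 : n ≠ 0 := by
    rintro rfl
    exact T.irrefl hn
  have := hT.isAcyclic.eq_snd_of_adj_start hw hn hs
  rw [h1 hn0] at this
  exact h.1 this

/-- If the first steps differed, uniqueness of paths would keep the rays from meeting again, and
together they would form a double ray. -/
theorem IsRay.snd_eq (hT : IsOneEndedTree T) {f g : ℕ → V} (hf : IsRay T f) (hg : IsRay T g)
    (h0 : f 0 = g 0) : f 1 = g 1 := by
  by_contra hne
  have hdisj : ∀ n k, f n ≠ g (k + 1) := by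
    intro n k h
    rcases Nat.eq_zero_or_pos n with rfl | hn
    · rw [h0] at h
      exact absurd (hg.1 h) (by omega)
    obtain ⟨w, hw, -, hw1, -⟩ := hf.exists_walk n
    obtain ⟨w', hw', -, hw1', -⟩ := hg.exists_walk (k + 1)
    have key : ∀ {a b a' b' : V} (w : T.Walk a b) (w' : T.Walk a' b'), a = a' → b = b' →
        w.IsPath → w'.IsPath → w.snd = w'.snd := by
      rintro a b _ _ w w' rfl rfl hw hw'
      have := hT.isTree.isAcyclic.subsingleton_path a b
      obtain rfl : w = w' :=
        congrArg Subtype.val (Subsingleton.elim (α := T.Path a b) ⟨w, hw⟩ ⟨w', hw'⟩)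
      rfl
    have := key w w' h0 h hw hw'
    rw [hw1 (by omega), hw1' (by omega)] at this
    exact hne this
  refine hT.not_containsDoubleRay ⟨fun | .ofNat n => f n | .negSucc n => g (n + 1), ?_, ?_⟩
  · rintro (a | a) (b | b) h
    · exact congrArg _ (hf.1 h)
    · exact absurd h (hdisj a b)
    · exact absurd h.symm (hdisj b a)
    · have := hg.1 h
      rw [Nat.add_right_cancel this]
  · rintro (a | _ | a)
    · exact hf.2 a
    · change T.Adj (g 1) (f 0)
      rw [h0]
      exact (hg.2 0).symm
    · exact (hg.2 (a + 1)).symm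

/-- Follow a walk back from a given ray: a vertex already on the current ray starts a tail of it,
any other can be prepended. -/
theorem exists_isRay (hT : IsOneEndedTree T) (v : V) : ∃ f, IsRay T f ∧ f 0 = v := by
  obtain ⟨r, hr⟩ := hT.containsRay
  obtain ⟨w⟩ := hT.isTree.connected.preconnected v (r 0)
  generalize hu : r 0 = u at w
  induction w with
  | nil => exact ⟨r, hr, hu⟩
  | @cons a b _ hab _ ih =>
    obtain ⟨f, hf, rfl⟩ := ih hu
    by_cases h : ∃ n, f n = a
    · obtain ⟨n, rfl⟩ := h
      exact ⟨_, hf.shift n, by simp⟩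
    · obtain ⟨g, hg, hg0, -⟩ := hf.cons hab fun n hn => h ⟨n, hn⟩
      exact ⟨g, hg, hg0⟩

/-- `p` sends every vertex to the next one in the direction of the end of `T`. -/
structure IsParentMap (T : SimpleGraph V) (p : V → V) : Prop where
  wf : WellFounded fun y x => p y = x
  adj_iff : ∀ a b, T.Adj a b ↔ p a = b ∨ p b = a
  map_parent : ∀ (φ : T ≃g T) v, p (φ v) = φ (p v)
  exists_common : ∀ a b, ∃ k n : ℕ, p^[k] a = p^[n] b

theorem exists_isParentMap (hT : IsOneEndedTree T) : ∃ p, IsParentMap T p := by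
  choose r hr hr0 using exists_isRay hT
  have hp : ∀ f, IsRay T f → r (f 0) 1 = f 1 := fun f hf => (hr _).snd_eq hT hf (hr0 _)
  have hpn : ∀ f, IsRay T f → ∀ n, r (f n) 1 = f (n + 1) := fun f hf n => by
    have := hp _ (hf.shift n)
    rwa [Nat.zero_add, Nat.add_comm 1 n] at this
  let p : V → V := fun v => r v 1
  have hiter : ∀ v n, p^[n] v = r v n := by
    intro v n
    induction n with
    | zero => exact (hr0 v).symm
    | succ n ih => rw [Function.iterate_succ_apply', ih]; exact hpn _ (hr v) n
  have hadj : ∀ v, T.Adj v (p v) := fun v => by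
    have := (hr v).2 0
    rwa [hr0] at this
  have hor : ∀ a b, T.Adj a b → p a = b ∨ p b = a := by
    intro a b hab
    by_cases h : ∃ n, r a n = b
    · obtain ⟨n, rfl⟩ := h
      left
      have hab' : T.Adj (r a 0) (r a n) := (hr0 a).symm ▸ hab
      rw [(hr a).eq_one_of_adj hT.isTree hab']
    -- Prepending `b` to the ray of `a` gives a ray from `b`, so its first step is the parent of
    -- `b`.
    · right
      obtain ⟨g, hg, hg0, hg1⟩ := (hr a).cons (v := b) ((hr0 a).symm ▸ hab.symm)
        fun n hn => h ⟨n, hn⟩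
      have := hp g hg
      rwa [hg0, hg1 0, hr0] at this
  refine ⟨p, ?_, fun a b => ⟨hor a b, ?_⟩, fun φ v => ?_, fun a b => ?_⟩
  -- An infinite chain of children joined to the ancestors of its top vertex would be a double ray.
  · rw [wellFounded_iff_isEmpty_descending_chain]
    refine ⟨fun ⟨f, hf⟩ => hT.not_containsDoubleRay
      ⟨fun | .ofNat n => f n | .negSucc n => p^[n + 1] (f 0), ?_, ?_⟩⟩
    · have hdown : ∀ n k, p^[n] (f (n + k)) = f k := by
        intro n k
        induction n with
        | zero => rw [Nat.zero_add]; rfl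
        | succ n ih =>
          rw [Function.iterate_succ_apply, Nat.add_right_comm, hf, ih]
      have hinj : ∀ v, Function.Injective fun n => p^[n] v := fun v a b h => by
        simp only [hiter] at h
        exact (hr v).1 h
      have hmix : ∀ n k, f n ≠ p^[k + 1] (f 0) := by
        intro n k h
        have h0 := hdown n 0
        rw [Nat.add_zero] at h0
        rw [← h0, ← Function.iterate_add_apply] at h
        exact absurd (hinj (f n) (a₁ := 0) h) (by omega)
      have hff : ∀ a k, f a ≠ f (a + k + 1) := by
        intro a k h
        have h1 := hdown (k + 1) a
        rw [show k + 1 + a = a + k + 1 by omega, ← h] at h1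
        exact absurd (hinj (f a) (a₁ := k + 1) (a₂ := 0) h1) (by omega)
      rintro (a | a) (b | b) h
      · rcases lt_trichotomy a b with hab | hab | hab
        · obtain ⟨k, rfl⟩ := Nat.exists_eq_add_of_lt hab
          exact absurd h (hff a k)
        · rw [hab]
        · obtain ⟨k, rfl⟩ := Nat.exists_eq_add_of_lt hab
          exact absurd h.symm (hff b k)
      · exact absurd h (hmix a b)
      · exact absurd h.symm (hmix b a)
      · have := hinj (f 0) h
        rw [Nat.add_right_cancel this]
    · rintro (a | _ | a)
      · change T.Adj (f a) (f (a + 1))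
        rw [← hf a]
        exact (hadj _).symm
      · exact (hadj _).symm
      · change T.Adj (p^[a + 2] (f 0)) (p^[a + 1] (f 0))
        rw [Function.iterate_succ_apply' p (a + 1)]
        exact (hadj _).symm
  · rintro (rfl | rfl)
    · exact hadj a
    · exact (hadj b).symm
  · have := hp _ ((hr v).map φ)
    rwa [hr0] at this
  · obtain ⟨w⟩ := hT.isTree.connected.preconnected a b
    induction w with
    | nil => exact ⟨0, 0, rfl⟩
    | @cons a c b hac _ ih =>
      obtain ⟨k, n, h⟩ := ih
      rcases hor a c hac with rfl | rfl
      · exact ⟨k + 1, n, h⟩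
      · refine ⟨k, n + 1, ?_⟩
        rw [Function.iterate_succ_apply', ← h, ← Function.iterate_succ_apply' p,
          Function.iterate_succ_apply]

/-! ### Automorphisms and the parent map -/

namespace IsParentMap

variable {p : V → V}

theorem map_iterate (hp : IsParentMap T p) (φ : T ≃g T) (n : ℕ) (v : V) :
    p^[n] (φ v) = φ (p^[n] v) := by
  induction n with
  | zero => rfl
  | succ n ih => rw [Function.iterate_succ_apply', ih, hp.map_parent,
      Function.iterate_succ_apply']

/-- No automorphism translates along the end. -/
theorem iterate_map_ne (hp : IsParentMap T p) (φ : T ≃g T) (d : ℕ) (w : V) :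
    p^[d + 1] (φ w) ≠ w := by
  intro h
  have hwf := hp.wf.transGen
  induction w using hwf.induction with
  | _ w ih =>
    refine ih (φ w) ?_ (by rw [hp.map_iterate, h])
    have := transGen_iterate (p := p) d (φ w)
    rwa [h] at this

/-- The ancestor lines of `v` and `φ v` meet. Meeting after unequal numbers of steps would make `φ`
or its inverse a translation; equal numbers give a fixed ancestor. -/
theorem exists_fixed_iterate (hp : IsParentMap T p) (φ : T ≃g T) (v : V) :
    ∃ n : ℕ, φ (p^[n] v) = p^[n] v := by
  obtain ⟨k, n, h⟩ := hp.exists_common v (φ v)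
  rcases lt_trichotomy k n with hkn | rfl | hkn
  · obtain ⟨d, rfl⟩ := Nat.exists_eq_add_of_lt hkn
    refine absurd ?_ (hp.iterate_map_ne φ d (p^[k] v))
    rw [← hp.map_iterate, ← Function.iterate_add_apply, show d + 1 + k = k + d + 1 by omega, h]
  · exact ⟨k, by rw [← hp.map_iterate, h]⟩
  · obtain ⟨d, rfl⟩ := Nat.exists_eq_add_of_lt hkn
    refine absurd ?_ (hp.iterate_map_ne φ.symm d (p^[n] (φ v)))
    rw [← hp.map_iterate, ← Function.iterate_add_apply, show d + 1 + n = n + d + 1 by omega]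
    rw [show φ.symm (φ v) = v from φ.symm_apply_apply v, h]

theorem colorIso_map (hp : IsParentMap T p) (φ : T ≃g T) {S S' : Set V} (h : φ '' S = S')
    (x : V) : ColorIso p S S' x (φ x) := by
  induction x using hp.wf.induction with
  | _ x ih =>
    refine .mk ?_ (φ.toEquiv.subtypeEquiv fun z => ?_) fun z => ih z.1 z.2
    · rw [← h]
      exact (φ.injective.mem_set_image).symm
    · change p z = x ↔ p (φ z) = φ x
      rw [hp.map_parent, φ.injective.eq_iff]

/-- Descend from a fixed ancestor: a colour-preserving automorphism fixing a vertex sends each child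
to a sibling of the same type, hence to itself. -/
theorem isAsymmetrizing (hp : IsParentMap T p) {S : Set V} {v : V}
    (h : ∀ n, SiblingRigid p S (p^[n] v)) : IsAsymmetrizing T S := by
  intro φ hφ
  have hup : ∀ x, φ x = x → φ (p x) = p x := fun x hx => by rw [← hp.map_parent, hx]
  have hdown : ∀ n x, φ (p^[n] x) = p^[n] x → φ x = x := by
    intro n x hx
    -- Every vertex has an ancestor on the line from `v`, so rigidity along that line is rigidity
    -- everywhere.
    have hrig : ∀ z, ∀ a b, p a = z → p b = z → ColorIso p S S a b → a = b := by
      intro z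
      obtain ⟨k, n, hkn⟩ := hp.exists_common z v
      exact h n z ⟨k, hkn⟩
    induction n with
    | zero => exact hx
    | succ n ih =>
      apply ih
      rw [Function.iterate_succ_apply'] at hx
      refine (hrig _ _ _ rfl ?_ (hp.colorIso_map φ hφ (p^[n] x))).symm
      rw [hp.map_parent, hx]
  ext x
  obtain ⟨n, hn⟩ := hp.exists_fixed_iterate φ x
  exact hdown n x hn

/-- The swap moves only vertices of two equinumerous trees, and the infinite `m` is at most twice
their size only if it is at most their size. -/
theorem isSpread (hp : IsParentMap T p) {m : Cardinal.{u}} (hm : ℵ₀ ≤ m)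
    (hmotion : (m : WithTop Cardinal.{u}) ≤ motion T) (hdeg : maxDegree T ≤ 2 ^ m) :
    IsSpread p m where
  wf := hp.wf
  infinite := hm
  le_descendants := by
    intro x y hxy hpxy h
    obtain ⟨σ, hσ, hσp, hσx, hmoved⟩ := exists_swap hp.wf hxy hpxy h
    have hσi : Function.Injective σ := Function.LeftInverse.injective hσ
    let φ : T ≃g T :=
      { toFun := σ
        invFun := σ
        left_inv := hσ
        right_inv := hσ
        map_rel_iff' := by
          intro a b
          change T.Adj (σ a) (σ b) ↔ T.Adj a b
          rw [hp.adj_iff, hp.adj_iff, hσp, hσp, hσi.eq_iff, hσi.eq_iff] }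
    have hφ : φ ≠ RelIso.refl T.Adj := fun h => hσx (DFunLike.congr_fun h x)
    have h1 : (m : WithTop Cardinal.{u}) ≤ (#{v : V // σ v ≠ v} : Cardinal.{u}) :=
      hmotion.trans (iInf_le (fun φ : {φ : T ≃g T // φ ≠ RelIso.refl T.Adj} =>
        ((#{v : V // φ.1 v ≠ v} : Cardinal.{u}) : WithTop Cardinal.{u})) ⟨φ, hφ⟩)
    have h2 : m ≤ #(descendants p x) + #(descendants p x) := by
      refine (WithTop.coe_le_coe.1 h1).trans ?_
      refine (Cardinal.mk_le_mk_of_subset (t := descendants p x ∪ descendants p y) hmoved).trans ?_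
      refine (Cardinal.mk_union_le _ _).trans ?_
      rw [h.mk_descendants_eq hp.wf]
    by_contra hlt
    exact (h2.trans_lt (Cardinal.add_lt_of_lt hm (not_le.1 hlt) (not_le.1 hlt))).false
  children_le := by
    intro x
    refine le_trans ?_ (le_trans (le_ciSup Cardinal.bddAbove_of_small x) hdeg)
    exact Cardinal.mk_le_mk_of_subset (s := {y | p y = x}) (t := T.neighborSet x)
      fun y hy => (hp.adj_iff x y).2 (Or.inr hy)

end IsParentMap

theorem IsOneEndedTree.asymmetrizingNumber_eq (hT : IsOneEndedTree T) (m : Cardinal.{u})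
    (hm : ℵ₀ ≤ m) (hmotion : (m : WithTop Cardinal.{u}) ≤ motion T)
    (hdeg : maxDegree T ≤ 2 ^ m) : asymmetrizingNumber T = 2 ^ #V := by
  obtain ⟨p, hp⟩ := exists_isParentMap hT
  obtain ⟨r, hr, -⟩ := hT.containsRay
  have hV : ℵ₀ ≤ #V := Cardinal.aleph0_le_mk_iff.2 (Infinite.of_injective r hr)
  apply le_antisymm
  · exact (Cardinal.mk_quotient_le.trans (Cardinal.mk_subtype_le _)).trans_eq Cardinal.mk_set
  obtain ⟨F, hF, hFinj⟩ := (hp.isSpread hm hmotion hdeg).exists_rigid_family (r 0) fun z => by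
    obtain ⟨k, n, h⟩ := hp.exists_common z (r 0)
    exact ⟨n, k, h⟩
  let C : Set V → Quotient (asymmetrizingSetoid T) := fun A =>
    Quotient.mk _ ⟨F A, hp.isAsymmetrizing (hF A)⟩
  have hC : ∀ A, ∃ φ : T ≃g T, φ '' (C A).out.1 = F A := fun A =>
    Quotient.exact (s := asymmetrizingSetoid T) (Quotient.out_eq (C A))
  choose φ hφ using hC
  -- Two sets in one class with the same preimage of `r 0` are related by an automorphism fixing `r
  -- 0`, and so encode the same `A`.
  have hinj : Function.Injective fun A => (C A, (φ A).symm (r 0)) := by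
    intro A A' h
    obtain ⟨h1, h2⟩ := Prod.mk.inj h
    apply hFinj
    intro n
    let ψ : T ≃g T := (φ A).symm.trans (φ A')
    have hψ : ψ '' F A = F A' := by
      rw [← hφ A, ← hφ A', ← h1, ← Set.image_comp]
      refine Set.image_congr fun z _ => ?_
      exact congrArg (φ A') ((φ A).symm_apply_apply z)
    have hψr : ψ (r 0) = r 0 := by
      change φ A' ((φ A).symm (r 0)) = r 0
      rw [h2]
      exact (φ A').apply_symm_apply (r 0)
    have := hp.colorIso_map ψ hψ (p^[n] (r 0))
    rwa [← hp.map_iterate, hψr] at this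
  have hle := Cardinal.mk_le_of_injective hinj
  rw [Cardinal.mk_set, Cardinal.mk_prod, Cardinal.lift_id, Cardinal.lift_id] at hle
  by_contra hlt
  have hlt' : #(Quotient (asymmetrizingSetoid T)) < 2 ^ #V := not_le.1 hlt
  exact (hle.trans_lt (Cardinal.mul_lt_of_lt (hV.trans (Cardinal.cantor _).le) hlt'
    (Cardinal.cantor _))).false

end Rays

end TreeAsymmetrization

theorem theorem4 {V : Type u} (T : SimpleGraph V) (hT : TreeAsymmetrization.IsOneEndedTree T)
    (m : Cardinal.{u}) (hm : ℵ₀ ≤ m)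
    (hmotion : (m : WithTop Cardinal.{u}) ≤ TreeAsymmetrization.motion T)
    (hdeg : TreeAsymmetrization.maxDegree T ≤ 2 ^ m) :
    TreeAsymmetrization.asymmetrizingNumber T = 2 ^ #V :=
  hT.asymmetrizingNumber_eq m hm hmotion hdeg
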